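/- Let $\mathcal X$ be a standard Borel space and $\mathcal Y$ a metric space, with metric $d$, whose topology is Polish. For $t=0,\dots,T$ let $P_t$ be a probability measure on $\mathcal X\times\mathcal Y$, the law of $(X_t,Y_t)$; write $P_t(X_t)$ for its marginal on $\mathcal X$ and $P_t(Y_t\mid X_t=x)$ for its conditional distributions. For a nonnegative measurable cost $c$ let $\mathcal W^{c}(\mu,\nu)=\inf_\pi\int c\,d\pi$, the infimum over all couplings $\pi$ of $\mu$ and $\nu$. Assume that the shift is gradually Lipschitz smooth in $X_t$: there are a measurable cost function $c:\mathcal X\times\mathcal X\to[0,\infty)$ and constants $\varepsilon_i\ge 0$, $L_i>0$ such that for $i=1,\dots,T$ $$\mathcal W^{c}\big(P_i(X_i),P_{i-1}(X_{i-1})\big)\le\varepsilon_i\quad\text{and}\quad \mathcal W^{d}\big(P_i(Y_i\mid X_i=x),P_{i-1}(Y_{i-1}\mid X_{i-1}=x')\big)\le L_i\,c(x,x')$$ for all realizations $x$ of $X_i$ and $x'$ of $X_{i-1}$ (that is, for all $x$ in a set of full $P_i(X_i)$-measure and all $x'$ in a set of full $P_{i-1}(X_{i-1})$-measure). For $i=1,\dots,T$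 let $\gamma_i$ be an optimal coupling of $P_i(X_i)$ and $P_{i-1}(X_{i-1})$ for the cost $c$, and let $\gamma_i(X_{i-1}\mid X_i)$ be its conditional distribution. Let $\Psi_t(X_0\mid X_t)$ be the composition of the transition kernels $\gamma_t(X_{t-1}\mid X_t),\dots,\gamma_1(X_0\mid X_1)$, and put $\hat P(Y_t\mid X_t=x)=\int P_0(Y_0\mid X_0=x_0)\,\Psi_t(dx_0\mid X_t=x)$. Let $f:\mathcal X\to\mathcal Y$ be a measurable model and let $\mathcal L:\mathcal Y\times\mathcal Y\to\mathbb R$ be a measurable loss function that is $1$-Lipschitz in its second argument with respect to $d$. Let $0\le t\le T$, assume that $\mathcal L(f(X_t),Y_t)$ is integrable under $P_t$, and set $$\mathcal L_t=\mathbb E_{P_t(X_t,Y_t)}\big[\mathcal L(f(X_t),Y_t)\big],\qquad \hat{\mathcal L}^{IUPM}_t=\mathbb E_{P_t(X_t)}\mathbb E_{\hat P(Y_t\mid X_t)}\big[\mathcal L(f(X_t),Y_t)\big].$$ Then $\mathcal L(f(X_t),Y_t)$ is also integrable under the joint law $P_t(X_t)\otimes\hat P(Y_t\mid X_t)$, so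 that $\hat{\mathcal L}^{IUPM}_t$ is well defined, and $$\big|\mathcal L_t-\hat{\mathcal L}^{IUPM}_t\big|\le\sum_{i=1}^{t}L_i\,\varepsilon_i .$$ In particular the worst-case estimation error grows at most linearly in $t$: if $L_i\varepsilon_i\le K$ for $i=1,\dots,t$, then $|\mathcal L_t-\hat{\mathcal L}^{IUPM}_t|\le K\,t$. -/

import Mathlib

open MeasureTheory ProbabilityTheory
open scoped NNReal ENNReal

noncomputable section

namespace IUPM

section Transport

variable {α β : Type*} [MeasurableSpace α] [MeasurableSpace β]

/-- `π` is a coupling of `μ` and `ν`: a measure on the product with these marginals. -/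
def IsCoupling (π : Measure (α × β)) (μ : Measure α) (ν : Measure β) : Prop :=
  π.fst = μ ∧ π.snd = ν

/-- The expected cost of a transport plan. -/
def transportCost (c : α → β → ℝ≥0) (π : Measure (α × β)) : ℝ≥0∞ :=
  ∫⁻ p, (c p.1 p.2 : ℝ≥0∞) ∂π

/-- The Wasserstein distance of order one for the cost `c`: the infimum of the expected cost
over all couplings. -/
def wasserstein (c : α → β → ℝ≥0) (μ : Measure α) (ν : Measure β) : ℝ≥0∞ :=
  ⨅ (π : Measure (α × β)) (_ : IsCoupling π μ ν), transportCost c π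

/-- `γ` is an optimal transport coupling: it minimizes the expected cost among all couplings. -/
def IsOptimalCoupling (c : α → β → ℝ≥0) (γ : Measure (α × β)) (μ : Measure α)
    (ν : Measure β) : Prop :=
  IsCoupling γ μ ν ∧ ∀ π : Measure (α × β), IsCoupling π μ ν → transportCost c γ ≤ transportCost c π

end Transport

variable {X Y : Type*} [MeasurableSpace X] [StandardBorelSpace X] [Nonempty X]
  [MetricSpace Y] [PolishSpace Y] [MeasurableSpace Y] [BorelSpace Y] [Nonempty Y]

/-- The joint laws `P 0, …, P T` on `X × Y` form a shift that is gradually Lipschitz smooth in the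
first coordinate, for the cost function `c` and the constants `L 1, …, L T` and `ε 1, …, ε T`.
Here `(P i).fst` is the law of `X_i` and `(P i).condKernel x` is the conditional law of `Y_i`
given `X_i = x`. As the latter is determined only up to null sets, "all realizations" means all
points of some set of full measure for `X_{i+1}`, respectively for `X_i`; for discrete laws these
sets contain every point of positive mass. -/
structure GraduallyLipschitzSmooth (T : ℕ) (P : ℕ → Measure (X × Y))
    [∀ i, IsProbabilityMeasure (P i)] (c : X → X → ℝ≥0) (L ε : ℕ → ℝ≥0) : Prop where
  measurable_cost : Measurable (fun p : X × X => c p.1 p.2)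
  wasserstein_le : ∀ i < T, wasserstein c (P (i + 1)).fst (P i).fst ≤ ε (i + 1)
  pos : ∀ i < T, 0 < L (i + 1)
  lipschitz : ∀ i < T, ∃ A ∈ ae (P (i + 1)).fst, ∃ B ∈ ae (P i).fst, ∀ x ∈ A, ∀ x' ∈ B,
    wasserstein (fun y y' : Y => nndist y y') ((P (i + 1)).condKernel x) ((P i).condKernel x')
      ≤ L (i + 1) * c x x'

/-- The overall transition kernel `Ψ_t(X_0 | X_t)`, composed of the conditional couplings
`γ_i(X_{i-1} | X_i)`, where `γ i` is a law of pairs `(X_i, X_{i-1})`. -/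
def Psi (γ : ℕ → Measure (X × X)) [∀ i, IsProbabilityMeasure (γ i)] : ℕ → Kernel X X
  | 0 => Kernel.id
  | t + 1 => Psi γ t ∘ₖ (γ (t + 1)).condKernel

/-- The estimated conditional law of `Y_t` given `X_t`: the mixture of the conditional laws of
`Y_0` given `X_0` with weights `Ψ_t(X_0 | X_t)`. -/
def labelEstimate (P : ℕ → Measure (X × Y)) [∀ i, IsProbabilityMeasure (P i)]
    (γ : ℕ → Measure (X × X)) [∀ i, IsProbabilityMeasure (γ i)] (t : ℕ) : Kernel X Y :=
  (P 0).condKernel ∘ₖ Psi γ t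

/-- The true performance of the model `f` at time `t`. -/
def trueLoss (P : ℕ → Measure (X × Y)) (loss : Y → Y → ℝ) (f : X → Y) (t : ℕ) : ℝ :=
  ∫ p, loss (f p.1) p.2 ∂(P t)

/-- The estimated performance of the model `f` at time `t`. -/
def estimatedLoss (P : ℕ → Measure (X × Y)) [∀ i, IsProbabilityMeasure (P i)]
    (γ : ℕ → Measure (X × X)) [∀ i, IsProbabilityMeasure (γ i)]
    (loss : Y → Y → ℝ) (f : X → Y) (t : ℕ) : ℝ :=
  ∫ x, ∫ y, loss (f x) y ∂(labelEstimate P γ t x) ∂(P t).fst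

end IUPM

end

universe u

/-! The proof telescopes along the chain of couplings. Adjoin `X_{t-1}` to `X_t` by the conditional
law of `γ t`, then replace the law of `Y` given `X_t` by that of `Y` given `X_{t-1}`. By the easy
half of Kantorovich–Rubinstein duality on each fiber this changes the expected loss by at most `L t`
times the mean of `c` under `γ t`, hence by at most `L t * ε t` since `γ t` is optimal. Iterating
down to time `0` yields `labelEstimate`. The loss keeps depending on `X_t` while the label kernel
moves back in time, so the induction is run for functions of a general `w` that retains the past
choices (`integrable_and_abs_integral_labelEstimate_sub_le`). A single replacement, which also
transfers integrability, is `integrable_and_abs_integral_compProd_sub_le`. -/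

namespace IUPM

section Lipschitz

/-- Integrating a nonnegative function that varies by at most `dist` costs at most the
Wasserstein distance. -/
theorem lintegral_le_lintegral_add_wasserstein {Y : Type*} [MetricSpace Y]
    [MeasurableSpace Y] {g₁ g₂ : Y → ℝ≥0∞} (hg₁ : Measurable g₁) (hg₂ : Measurable g₂)
    (hg : ∀ y y', g₂ y' ≤ g₁ y + nndist y y') (μ ν : Measure Y) :
    ∫⁻ y, g₂ y ∂ν ≤ ∫⁻ y, g₁ y ∂μ + wasserstein (fun y y' : Y => nndist y y') μ ν := by
  unfold wasserstein
  simp only [ENNReal.add_iInf]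
  refine le_iInf₂ fun π hπ => ?_
  rw [← hπ.1, ← hπ.2, Measure.fst, Measure.snd, lintegral_map hg₂ measurable_snd,
    lintegral_map hg₁ measurable_fst, transportCost,
    ← lintegral_add_left (by fun_prop)]
  exact lintegral_mono fun p => hg p.1 p.2

variable {Y : Type*} [MetricSpace Y] [MeasurableSpace Y] [BorelSpace Y]

/-- Needs no integrability under `ν`, and so serves to transfer integrability from one kernel to the
other. -/
theorem lintegral_enorm_le_add_wasserstein {g : Y → ℝ} (hg : LipschitzWith 1 g)
    (μ ν : Measure Y) :
    ∫⁻ y, ‖g y‖ₑ ∂ν ≤ ∫⁻ y, ‖g y‖ₑ ∂μ + wasserstein (fun y y' : Y => nndist y y') μ ν := by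
  refine lintegral_le_lintegral_add_wasserstein hg.continuous.measurable.enorm
    hg.continuous.measurable.enorm (fun y y' => ?_) μ ν
  have h : ‖g y'‖₊ ≤ ‖g y‖₊ + nndist y y' := by
    rw [← NNReal.coe_le_coe]
    push_cast
    have h1 := hg.dist_le_mul y y'
    rw [Real.dist_eq, NNReal.coe_one, one_mul] at h1
    have h2 := abs_sub_abs_le_abs_sub (g y') (g y)
    rw [abs_sub_comm] at h2
    simp only [Real.norm_eq_abs]
    linarith
  rw [enorm_eq_nnnorm, enorm_eq_nnnorm]
  exact_mod_cast h

/-- The easy half of Kantorovich–Rubinstein duality. -/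
theorem enorm_integral_sub_integral_le_wasserstein {g : Y → ℝ} (hg : LipschitzWith 1 g)
    {μ ν : Measure Y} (hμ : Integrable g μ) (hν : Integrable g ν) :
    ‖∫ y, g y ∂μ - ∫ y, g y ∂ν‖ₑ ≤ wasserstein (fun y y' : Y => nndist y y') μ ν := by
  refine le_iInf₂ fun π hπ => ?_
  have hm := hg.continuous.measurable
  rw [← hπ.1, Measure.fst] at hμ ⊢
  rw [← hπ.2, Measure.snd] at hν ⊢
  rw [integral_map measurable_fst.aemeasurable hm.aestronglyMeasurable,
    integral_map measurable_snd.aemeasurable hm.aestronglyMeasurable,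
    ← integral_sub (f := fun p : Y × Y => g p.1) (g := fun p : Y × Y => g p.2)
      (hμ.comp_measurable measurable_fst) (hν.comp_measurable measurable_snd)]
  refine (enorm_integral_le_lintegral_enorm _).trans (lintegral_mono fun p => ?_)
  have h := hg.edist_le_mul p.1 p.2
  rw [ENNReal.coe_one, one_mul, edist_eq_enorm_sub, edist_nndist] at h
  exact h

/-- If two kernels are fiberwise close in Wasserstein distance, replacing one by the other changes
the integral of a function that is `1`-Lipschitz along the fibers by at most the mean distance. -/
theorem integrable_and_abs_integral_compProd_sub_le {Z : Type*} [MeasurableSpace Z]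
    {m : Measure Z} [SFinite m] {κ₁ κ₂ : Kernel Z Y} [IsSFiniteKernel κ₁] [IsSFiniteKernel κ₂]
    {h : Z × Y → ℝ} (hm : Measurable h) (hlip : ∀ z, LipschitzWith 1 fun y => h (z, y))
    {C : Z → ℝ≥0∞} {D : ℝ≥0}
    (hC : ∀ᵐ z ∂m, wasserstein (fun y y' : Y => nndist y y') (κ₁ z) (κ₂ z) ≤ C z)
    (hD : ∫⁻ z, C z ∂m ≤ D) (hint : Integrable h (m ⊗ₘ κ₁)) :
    Integrable h (m ⊗ₘ κ₂) ∧ |∫ p, h p ∂(m ⊗ₘ κ₁) - ∫ p, h p ∂(m ⊗ₘ κ₂)| ≤ D := by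
  have hint₂ : Integrable h (m ⊗ₘ κ₂) := by
    refine ⟨hm.aestronglyMeasurable, ?_⟩
    have hfin := hint.2
    rw [HasFiniteIntegral, Measure.lintegral_compProd hm.enorm] at hfin ⊢
    calc ∫⁻ z, ∫⁻ y, ‖h (z, y)‖ₑ ∂κ₂ z ∂m
        ≤ ∫⁻ z, ((∫⁻ y, ‖h (z, y)‖ₑ ∂κ₁ z) + C z) ∂m :=
          lintegral_mono_ae (hC.mono fun z hz =>
            (lintegral_enorm_le_add_wasserstein (hlip z) _ _).trans (by gcongr))
      -- `C` need not be measurable: only the first summand has to be.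
      _ = (∫⁻ z, ∫⁻ y, ‖h (z, y)‖ₑ ∂κ₁ z ∂m) + ∫⁻ z, C z ∂m :=
          lintegral_add_left hm.enorm.lintegral_kernel_prod_right' _
      _ < ∞ := ENNReal.add_lt_top.2 ⟨hfin, hD.trans_lt ENNReal.coe_lt_top⟩
  refine ⟨hint₂, ?_⟩
  have hI₁ : Integrable (fun z => ∫ y, h (z, y) ∂κ₁ z) m := hint.integral_compProd
  have hI₂ : Integrable (fun z => ∫ y, h (z, y) ∂κ₂ z) m := hint₂.integral_compProd
  rw [Measure.integral_compProd hint, Measure.integral_compProd hint₂,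
    ← integral_sub hI₁ hI₂, ← Real.norm_eq_abs,
    ← coe_nnnorm, NNReal.coe_le_coe, ← ENNReal.coe_le_coe, ← enorm_eq_nnnorm]
  refine (enorm_integral_le_lintegral_enorm _).trans ((lintegral_mono_ae ?_).trans hD)
  filter_upwards [hC, hint.ae_of_compProd, hint₂.ae_of_compProd] with z hz h₁ h₂
  exact (enorm_integral_sub_integral_le_wasserstein (hlip z) h₁ h₂).trans hz

end Lipschitz

section Extension

variable {X Y W : Type*} [MeasurableSpace X] [MeasurableSpace Y] [MeasurableSpace W]
  (ρ : Measure W) [SFinite ρ] {ξ : W → X} (hξ : Measurable ξ)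

/-- Forgetting an intermediate variable that does not influence the final one. -/
theorem map_compProd_compProd_comap_fst (κ : Kernel W X) [IsMarkovKernel κ] (η : Kernel X Y)
    [IsSFiniteKernel η] :
    ((ρ ⊗ₘ κ) ⊗ₘ η.comap (fun p : W × X => ξ p.1) (hξ.comp measurable_fst)).map
      (fun q => (q.1.1, q.2)) = ρ ⊗ₘ η.comap ξ hξ := by
  have hq : Measurable fun q : (W × X) × Y => (q.1.1, q.2) := by fun_prop
  refine Measure.ext_of_lintegral _ fun g hg => ?_
  rw [lintegral_map hg hq, Measure.lintegral_compProd (by fun_prop),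
    Measure.lintegral_compProd hg, Measure.lintegral_compProd]
  · simp [Kernel.comap_apply]
  · exact (hg.comp hq).lintegral_kernel_prod_right'

/-- Forgetting an intermediate variable composes the transition kernels. -/
theorem map_compProd_compProd_comap_snd (κ : Kernel X X) [IsSFiniteKernel κ] (η : Kernel X Y)
    [IsSFiniteKernel η] :
    ((ρ ⊗ₘ κ.comap ξ hξ) ⊗ₘ η.comap Prod.snd measurable_snd).map
      (fun q => (q.1.1, q.2)) = ρ ⊗ₘ (η ∘ₖ κ).comap ξ hξ := by
  have hq : Measurable fun q : (W × X) × Y => (q.1.1, q.2) := by fun_prop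
  refine Measure.ext_of_lintegral _ fun g hg => ?_
  rw [lintegral_map hg hq, Measure.lintegral_compProd (by fun_prop),
    Measure.lintegral_compProd hg, Measure.lintegral_compProd]
  · refine lintegral_congr fun w => ?_
    simp only [Kernel.comap_apply]
    rw [Kernel.lintegral_comp _ _ _ (by fun_prop)]
  · exact (hg.comp hq).lintegral_kernel_prod_right'

/-- If `ξ` has the first marginal of `γ` as its law, then adjoining a variable by the conditional
law of `γ` realizes `γ` as a joint law. -/
theorem map_compProd_condKernel_comap [StandardBorelSpace X] [Nonempty X] (γ : Measure (X × X))
    [IsFiniteMeasure γ] (hρ : ρ.map ξ = γ.fst) :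
    (ρ ⊗ₘ γ.condKernel.comap ξ hξ).map (fun p => (ξ p.1, p.2)) = γ := by
  conv_rhs => rw [← γ.disintegrate γ.condKernel, ← hρ]
  refine Measure.ext_of_lintegral _ fun g hg => ?_
  rw [lintegral_map hg (by fun_prop), Measure.lintegral_compProd (by fun_prop),
    Measure.lintegral_compProd hg, lintegral_map hg.lintegral_kernel_prod_right' hξ]
  simp [Kernel.comap_apply]

end Extension

variable {X Y : Type*} [MeasurableSpace X] [StandardBorelSpace X] [Nonempty X]
  [MetricSpace Y] [PolishSpace Y] [MeasurableSpace Y] [BorelSpace Y] [Nonempty Y]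

instance isMarkovKernel_Psi (γ : ℕ → Measure (X × X)) [∀ i, IsProbabilityMeasure (γ i)] (t : ℕ) :
    IsMarkovKernel (Psi γ t) := by
  induction t with
  | zero => rw [Psi]; infer_instance
  | succ t ih => rw [Psi]; infer_instance

instance isMarkovKernel_labelEstimate (P : ℕ → Measure (X × Y)) [∀ i, IsProbabilityMeasure (P i)]
    (γ : ℕ → Measure (X × X)) [∀ i, IsProbabilityMeasure (γ i)] (t : ℕ) :
    IsMarkovKernel (labelEstimate P γ t) := by
  rw [labelEstimate]; infer_instance

theorem transportCost_le_of_isOptimalCoupling {α β : Type*} [MeasurableSpace α]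
    [MeasurableSpace β] {c : α → β → ℝ≥0} {γ : Measure (α × β)} {μ : Measure α} {ν : Measure β}
    (h : IsOptimalCoupling c γ μ ν) : transportCost c γ ≤ wasserstein c μ ν :=
  le_iInf₂ h.2

/-- The error bound for functions that may depend on a further random element `w` from which
`X_t = ξ w` is computed. -/
theorem integrable_and_abs_integral_labelEstimate_sub_le {X : Type u} [MeasurableSpace X]
    [StandardBorelSpace X] [Nonempty X] {T : ℕ} {P : ℕ → Measure (X × Y)}
    [∀ i, IsProbabilityMeasure (P i)] {c : X → X → ℝ≥0} {L ε : ℕ → ℝ≥0}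
    (hP : GraduallyLipschitzSmooth T P c L ε)
    {γ : ℕ → Measure (X × X)} [∀ i, IsProbabilityMeasure (γ i)]
    (hγ : ∀ i < T, IsOptimalCoupling c (γ (i + 1)) (P (i + 1)).fst (P i).fst)
    (t : ℕ) (ht : t ≤ T) {W : Type u} [MeasurableSpace W] (ρ : Measure W)
    [IsProbabilityMeasure ρ] {ξ : W → X} (hξ : Measurable ξ) (hρ : ρ.map ξ = (P t).fst)
    {h : W × Y → ℝ} (hm : Measurable h) (hlip : ∀ w, LipschitzWith 1 fun y => h (w, y))
    (hint : Integrable h (ρ ⊗ₘ (P t).condKernel.comap ξ hξ)) :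
    Integrable h (ρ ⊗ₘ (labelEstimate P γ t).comap ξ hξ) ∧
    |∫ p, h p ∂(ρ ⊗ₘ (P t).condKernel.comap ξ hξ)
        - ∫ p, h p ∂(ρ ⊗ₘ (labelEstimate P γ t).comap ξ hξ)|
      ≤ ∑ i ∈ Finset.Icc 1 t, (L i : ℝ) * (ε i : ℝ) := by
  -- `W` varies because the step passes to `W × X`; `W` and `X` share a universe so that this
  -- product is again admissible.
  induction t generalizing W with
  | zero =>
    have h0 : labelEstimate P γ 0 = (P 0).condKernel := by
      rw [labelEstimate, Psi, Kernel.comp_id]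
    rw [h0]
    exact ⟨hint, by simp⟩
  | succ t ih =>
    have htT : t < T := ht
    have hopt := hγ t htT
    -- The law of `w` with an adjoined `X_t`, where `ξ w` plays `X_{t+1}`.
    set ρ' := ρ ⊗ₘ (γ (t + 1)).condKernel.comap ξ hξ with hρ'_def
    have hjoint : ρ'.map (fun p => (ξ p.1, p.2)) = γ (t + 1) :=
      map_compProd_condKernel_comap ρ hξ _ (hρ.trans hopt.1.1.symm)
    have hpair : Measurable fun p : W × X => (ξ p.1, p.2) := by fun_prop
    have hfst : ρ'.map (fun p => ξ p.1) = (P (t + 1)).fst := by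
      rw [← hopt.1.1, ← hjoint, Measure.fst, Measure.map_map measurable_fst hpair]
      rfl
    have hsnd : ρ'.map Prod.snd = (P t).fst := by
      rw [← hopt.1.2, ← hjoint, Measure.snd, Measure.map_map measurable_snd hpair]
      rfl
    have hforget : Measurable fun q : (W × X) × Y => (q.1.1, q.2) := by fun_prop
    have hmap₁ := map_compProd_compProd_comap_fst ρ hξ
      ((γ (t + 1)).condKernel.comap ξ hξ) (P (t + 1)).condKernel
    have hmap₂ := map_compProd_compProd_comap_snd ρ hξ (γ (t + 1)).condKernel
      (labelEstimate P γ t)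
    have hsucc : labelEstimate P γ t ∘ₖ (γ (t + 1)).condKernel = labelEstimate P γ (t + 1) := by
      rw [labelEstimate, labelEstimate, Psi, Kernel.comp_assoc]
    rw [hsucc] at hmap₂
    rw [← hρ'_def] at hmap₁ hmap₂
    -- Lifting both laws to `(W × X) × Y` makes room for the intermediate one, in which `Y` is drawn
    -- from `(P t).condKernel` at the adjoined point.
    rw [← hmap₁] at hint ⊢
    rw [← hmap₂]
    rw [integral_map hforget.aemeasurable hm.aestronglyMeasurable,
      integral_map hforget.aemeasurable hm.aestronglyMeasurable,
      integrable_map_measure hm.aestronglyMeasurable hforget.aemeasurable]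
    obtain ⟨A, hA, B, hB, hAB⟩ := hP.lipschitz t htT
    have hCint : ∫⁻ p, (L (t + 1) * c (ξ p.1) p.2 : ℝ≥0∞) ∂ρ'
        ≤ (L (t + 1) * ε (t + 1) : ℝ≥0) := by
      have hcm : Measurable fun p : X × X => (c p.1 p.2 : ℝ≥0∞) :=
        hP.measurable_cost.coe_nnreal_ennreal
      have hcm' : Measurable fun p : W × X => (c (ξ p.1) p.2 : ℝ≥0∞) := hcm.comp hpair
      rw [lintegral_const_mul _ hcm', ENNReal.coe_mul]
      gcongr
      rw [← lintegral_map (f := fun p : X × X => (c p.1 p.2 : ℝ≥0∞)) hcm hpair, hjoint]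
      exact (transportCost_le_of_isOptimalCoupling hopt).trans (hP.wasserstein_le t htT)
    obtain ⟨hstep_int, hstep⟩ := integrable_and_abs_integral_compProd_sub_le
      (m := ρ') (κ₁ := (P (t + 1)).condKernel.comap (fun p : W × X => ξ p.1)
        (hξ.comp measurable_fst))
      (κ₂ := (P t).condKernel.comap Prod.snd measurable_snd)
      (h := fun q => h (q.1.1, q.2)) (hm.comp hforget) (fun z => hlip z.1)
      (C := fun p => L (t + 1) * c (ξ p.1) p.2)
      (by
        -- The exceptional sets concern each coordinate separately, so the marginals of `γ (t + 1)`
        -- suffice.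
        have hA' : ∀ᵐ p ∂ρ', ξ p.1 ∈ A :=
          ae_of_ae_map (f := fun p : W × X => ξ p.1) (hξ.comp measurable_fst).aemeasurable
            (by rw [hfst]; exact hA)
        have hB' : ∀ᵐ p ∂ρ', p.2 ∈ B :=
          ae_of_ae_map measurable_snd.aemeasurable (by rw [hsnd]; exact hB)
        filter_upwards [hA', hB'] with p hpA hpB
        exact hAB _ hpA _ hpB)
      hCint (hint.comp_measurable hforget)
    obtain ⟨hrest_int, hrest⟩ := ih htT.le ρ' measurable_snd hsnd (hm.comp hforget)
      (fun z => hlip z.1) hstep_int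
    refine ⟨hrest_int, ?_⟩
    rw [Finset.sum_Icc_succ_top (by omega), add_comm (∑ i ∈ _, _)]
    push_cast at hstep
    exact (abs_sub_le _ _ _).trans (add_le_add hstep hrest)

end IUPM

theorem theorem1 {X Y : Type*} [MeasurableSpace X] [StandardBorelSpace X] [Nonempty X]
    [MetricSpace Y] [PolishSpace Y] [MeasurableSpace Y] [BorelSpace Y] [Nonempty Y]
    (T : ℕ) (P : ℕ → Measure (X × Y)) [∀ i, IsProbabilityMeasure (P i)]
    (c : X → X → ℝ≥0) (L ε : ℕ → ℝ≥0)
    (hP : IUPM.GraduallyLipschitzSmooth T P c L ε)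
    (γ : ℕ → Measure (X × X)) [∀ i, IsProbabilityMeasure (γ i)]
    (hγ : ∀ i < T, IUPM.IsOptimalCoupling c (γ (i + 1)) (P (i + 1)).fst (P i).fst)
    (f : X → Y) (hf : Measurable f)
    (loss : Y → Y → ℝ) (hloss : Measurable (fun p : Y × Y => loss p.1 p.2))
    (hlip : ∀ u : Y, LipschitzWith 1 (loss u))
    (t : ℕ) (ht : t ≤ T)
    (hint : Integrable (fun p : X × Y => loss (f p.1) p.2) (P t)) :
    Integrable (fun p : X × Y => loss (f p.1) p.2) ((P t).fst ⊗ₘ IUPM.labelEstimate P γ t) ∧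
    |IUPM.trueLoss P loss f t - IUPM.estimatedLoss P γ loss f t|
      ≤ ∑ i ∈ Finset.Icc 1 t, (L i : ℝ) * (ε i : ℝ) ∧
    ∀ K : ℝ, (∀ i ∈ Finset.Icc 1 t, (L i : ℝ) * (ε i : ℝ) ≤ K) →
      |IUPM.trueLoss P loss f t - IUPM.estimatedLoss P γ loss f t| ≤ K * t := by
  have hm : Measurable fun p : X × Y => loss (f p.1) p.2 :=
    hloss.comp (by fun_prop : Measurable fun p : X × Y => (f p.1, p.2))
  have hdis : (P t).fst ⊗ₘ (P t).condKernel = P t := (P t).disintegrate _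
  -- Initially `w` is `X_t` itself, with `ξ = id`.
  obtain ⟨hI, hle⟩ := IUPM.integrable_and_abs_integral_labelEstimate_sub_le hP hγ t ht (P t).fst
    measurable_id Measure.map_id hm (fun x => hlip (f x))
    (by rw [Kernel.comap_id, hdis]; exact hint)
  rw [Kernel.comap_id] at hI
  rw [Kernel.comap_id, Kernel.comap_id, hdis, Measure.integral_compProd hI] at hle
  refine ⟨hI, hle, fun K hK => hle.trans ((Finset.sum_le_card_nsmul _ _ K hK).trans_eq ?_)⟩
  simp [mul_comm]
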